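/- Let $d\ge 1$. For a potential $W:\mathbb{R}^d\to\mathbb{R}\cup\{\infty\}$ that is locally integrable, bounded from below, lower semicontinuous and even, set $$E[\rho]=\frac12\int_{\mathbb{R}^d}\int_{\mathbb{R}^d}W(\mathbf{x}-\mathbf{y})\,\mathrm{d}\rho(\mathbf{y})\,\mathrm{d}\rho(\mathbf{x})\in\mathbb{R}\cup\{\infty\}$$ for Borel probability measures $\rho$ on $\mathbb{R}^d$; a minimizer for $W$ is a probability measure that minimizes $E$ among all probability measures. Call $W$ admissible if, moreover, $W_\infty:=\lim_{|\mathbf{x}|\to\infty}W(\mathbf{x})$ exists in $\mathbb{R}\cup\{\infty\}$ and $E[\rho]<\frac12 W_\infty$ for some probability measure $\rho$. A number $R_*\in(0,\infty)$ is called an upper bound of minimizer size for $W$ if $W$ is admissible, every minimizer for $W$ is compactly supported, and every minimizer $\rho$ for $W$ with $\int_{\mathbb{R}^d}\mathbf{x}\,\mathrm{d}\rho(\mathbf{x})=0$ satisfies $\operatorname{supp}\rho\subset\overline{B(0;R_*)}$. For real numbers $-d<b<a$ let $$W_{a,b}(\mathbf{x})=\frac{|\mathbf{x}|^a}{a}-\frac{|\mathbf{x}|^b}{b},$$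 where $\frac{|\mathbf{x}|^0}{0}$ is understood as $\ln|\mathbf{x}|$ and $W_{a,b}(0)=\lim_{\mathbf{x}\to0}W_{a,b}(\mathbf{x})\in\mathbb{R}\cup\{\infty\}$. **Theorem.** For every $b>-d$ and every $a_0>\max\{b,0\}$ there exists $R_*=R_*(b,a_0)\in(0,\infty)$ (which may also depend on the dimension $d$, but not on $a$) that is an upper bound of minimizer size for $W_{a,b}$ for all $a\ge a_0$ simultaneously. -/

import Mathlib

open MeasureTheory Filter Topology

noncomputable section

/-- The interaction energy `E[ρ] = ½ ∫∫ W(x - y) dρ(y) dρ(x)` with values in the extended reals: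
the integral of the positive part minus the integral of the negative part. For `W` bounded from
below and a probability measure `ρ` the second integral is finite, so the value is in `ℝ ∪ {∞}`. -/
def interactionEnergy {d : ℕ} (W : EuclideanSpace ℝ (Fin d) → EReal)
    (ρ : ProbabilityMeasure (EuclideanSpace ℝ (Fin d))) : EReal :=
  ((1 / 2 : ℝ) : EReal) *
    (((∫⁻ x, ∫⁻ y, (W (x - y)).toENNReal ∂(ρ : Measure (EuclideanSpace ℝ (Fin d)))
        ∂(ρ : Measure (EuclideanSpace ℝ (Fin d))) : ENNReal) : EReal) -
      ((∫⁻ x, ∫⁻ y, (-W (x - y)).toENNReal ∂(ρ : Measure (EuclideanSpace ℝ (Fin d)))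
        ∂(ρ : Measure (EuclideanSpace ℝ (Fin d))) : ENNReal) : EReal))

/-- `ρ` minimizes the interaction energy of `W` among all probability measures on `ℝ^d`. -/
def IsEnergyMinimizer {d : ℕ} (W : EuclideanSpace ℝ (Fin d) → EReal)
    (ρ : ProbabilityMeasure (EuclideanSpace ℝ (Fin d))) : Prop :=
  ∀ ρ' : ProbabilityMeasure (EuclideanSpace ℝ (Fin d)),
    interactionEnergy W ρ ≤ interactionEnergy W ρ'

/-- The basic assumption on an interaction potential `W : ℝ^d → ℝ ∪ {∞}`: locally integrable,
bounded from below, lower semicontinuous and even. -/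
structure BasicAssumption {d : ℕ} (W : EuclideanSpace ℝ (Fin d) → EReal) : Prop where
  locallyIntegrable : ∀ K : Set (EuclideanSpace ℝ (Fin d)), IsCompact K →
    ∫⁻ x in K, (W x).abs ∂volume < ⊤
  boundedBelow : ∃ m : ℝ, ∀ x, (m : EReal) ≤ W x
  lowerSemicontinuous : LowerSemicontinuous W
  even : ∀ x, W (-x) = W x

/-- The standing assumptions on an interaction potential: the basic assumption, existence of the
limit `W∞ ∈ ℝ ∪ {∞}` of `W` at infinity, and a probability measure of energy below `½ W∞`. -/
structure IsAdmissiblePotential {d : ℕ} (W : EuclideanSpace ℝ (Fin d) → EReal) : Prop where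
  basic : BasicAssumption W
  limit : ∃ Winf : EReal, Winf ≠ ⊥ ∧ Tendsto W (cocompact (EuclideanSpace ℝ (Fin d))) (𝓝 Winf) ∧
    ∃ ρ : ProbabilityMeasure (EuclideanSpace ℝ (Fin d)),
      interactionEnergy W ρ < ((1 / 2 : ℝ) : EReal) * Winf

/-- `R ∈ (0, ∞)` is an upper bound of minimizer size for the admissible potential `W`. -/
structure IsUpperBoundOfMinimizerSize {d : ℕ} (W : EuclideanSpace ℝ (Fin d) → EReal)
    (R : ℝ) : Prop where
  admissible : IsAdmissiblePotential W
  pos : 0 < R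
  compactSupport : ∀ ρ : ProbabilityMeasure (EuclideanSpace ℝ (Fin d)),
    IsEnergyMinimizer W ρ → IsCompact (ρ : Measure (EuclideanSpace ℝ (Fin d))).support
  support_subset : ∀ ρ : ProbabilityMeasure (EuclideanSpace ℝ (Fin d)),
    IsEnergyMinimizer W ρ → ∫ x, x ∂(ρ : Measure (EuclideanSpace ℝ (Fin d))) = 0 →
      (ρ : Measure (EuclideanSpace ℝ (Fin d))).support ⊆ Metric.closedBall 0 R

/-- The function `t ^ c / c` of `t > 0`, understood as `log t` when `c = 0`. -/
def powerTerm (c t : ℝ) : ℝ :=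
  if c = 0 then Real.log t else t ^ c / c

/-- The power-law potential `|x|^a / a - |x|^b / b` for `b < a`, with its limit as value at the
origin, which is `∞` for `b ≤ 0` (and `0` for `b > 0`). -/
def powerLawPotential (d : ℕ) (a b : ℝ) (x : EuclideanSpace ℝ (Fin d)) : EReal :=
  open Classical in
  if x = 0 ∧ b ≤ 0 then ⊤ else ((powerTerm a ‖x‖ - powerTerm b ‖x‖ : ℝ) : EReal)

end

/-! If `W ≥ -M`, then `W + M` is a nonnegative kernel, and minimizing the energy amounts to
minimizing its quadratic form. For a minimizer of finite energy `I`, the Euler–Lagrange equation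
says that the potential `∫ (W(x - y) + M) dρ(y)` equals `I` for almost every `x`, and a test measure
gives `I ≤ C`. If `W + M ≥ G > 2C` at distances above `L`, then for almost every `x` less than half
of the mass lies outside the ball of radius `L` about `x`. Two such balls must meet, so `ρ` lives on
a set of diameter at most `2L`; centring puts the support in the ball of radius `2L`.

It remains to choose `M`, `C`, `L` independently of `a ≥ a₀`. By Bernoulli
(`powerTerm_sub_inv_mono`), `(t ^ a - 1) / a` increases in `a`, so lower bounds for `a₀` persist up
to a loss of `1 / a₀`; this gives `M` and `L`. For `C`, the test measure is uniform on a ball of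
diameter 1, where `t ^ a / a ≤ 1 / a₀`. -/

/-- The quadratic form of a nonnegative kernel, extended to a bilinear form in two measures. -/
noncomputable def kernelForm {X : Type*} [MeasurableSpace X] (K : X → X → ENNReal)
    (μ ν : Measure X) : ENNReal :=
  ∫⁻ x, ∫⁻ y, K x y ∂ν ∂μ

/-! ### Quadratic forms and the Euler–Lagrange equation. -/

section kernelForm

variable {X : Type*} [MeasurableSpace X] {K : X → X → ENNReal}

lemma kernelForm_comm (hK : Measurable (Function.uncurry K)) (hsymm : ∀ x y, K x y = K y x)
    (μ ν : Measure X) [SFinite μ] [SFinite ν] : kernelForm K μ ν = kernelForm K ν μ := by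
  unfold kernelForm
  rw [lintegral_lintegral_swap hK.aemeasurable]
  simp_rw [hsymm]

lemma kernelForm_mix (hK : Measurable (Function.uncurry K)) (hsymm : ∀ x y, K x y = K y x)
    (μ ν : Measure X) [SFinite μ] [SFinite ν] (s t : ENNReal) :
    kernelForm K (s • μ + t • ν) (s • μ + t • ν) =
      s * (s * kernelForm K μ μ) + 2 * (s * (t * kernelForm K ν μ)) +
        t * (t * kernelForm K ν ν) := by
  have hV : ∀ (τ : Measure X) [SFinite τ], Measurable fun x => ∫⁻ y, K x y ∂τ :=
    fun τ _ => hK.lintegral_prod_right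
  have e := kernelForm_comm hK hsymm μ ν
  unfold kernelForm at e ⊢
  simp only [lintegral_add_measure, lintegral_smul_measure, smul_eq_mul]
  rw [lintegral_add_left ((hV μ).const_mul s), lintegral_add_left ((hV μ).const_mul s),
    lintegral_const_mul _ (hV μ), lintegral_const_mul _ (hV μ),
    lintegral_const_mul _ (hV ν), lintegral_const_mul _ (hV ν), e]
  ring

/-- Along a segment starting at a minimum of a quadratic form, the derivative is nonnegative. -/
lemma le_of_forall_le_quadratic {I A Y : ℝ} (hI : 0 ≤ I) (hA : 0 ≤ A) (hY : 0 ≤ Y)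
    (h : ∀ t : ℝ, 0 < t → t < 1 →
      I ≤ (1 - t) * ((1 - t) * I) + 2 * ((1 - t) * (t * A)) + t * (t * Y)) : I ≤ A := by
  by_contra! hlt
  set δ := I - A with hδ
  have hδ0 : 0 < δ := sub_pos.2 hlt
  have hden : 0 < 2 * δ + I + Y := by positivity
  -- With `A = I - δ`, the hypothesis divided by `t` reads `0 ≤ -2δ + t (2δ - I + Y)`; this `t`
  -- makes the last term at most `δ`.
  have ht0 : 0 < δ / (2 * δ + I + Y) := by positivity
  have ht1 : δ / (2 * δ + I + Y) < 1 := by rw [div_lt_one hden]; linarith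
  set t := δ / (2 * δ + I + Y) with ht
  have htd : t * (2 * δ + I + Y) = δ := by rw [ht]; field_simp
  have h1 := h t ht0 ht1
  have h2 : 0 ≤ t * (-2 * δ + t * (I - 2 * A + Y)) := by
    have : A = I - δ := by rw [hδ]; ring
    rw [this] at h1 ⊢
    linarith
  have h3 := nonneg_of_mul_nonneg_right h2 ht0
  nlinarith [mul_nonneg ht0.le hA, mul_pos ht0 hδ0]

/-- Euler–Lagrange equation: the potential generated by a minimizer of finite energy is almost
everywhere equal to the energy. -/
theorem ae_lintegral_eq_of_forall_kernelForm_le (hK : Measurable (Function.uncurry K))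
    (hsymm : ∀ x y, K x y = K y x) (ρ : Measure X) [IsProbabilityMeasure ρ]
    (hfin : kernelForm K ρ ρ ≠ ⊤)
    (hmin : ∀ σ : Measure X, IsProbabilityMeasure σ → kernelForm K ρ ρ ≤ kernelForm K σ σ) :
    ∀ᵐ x ∂ρ, ∫⁻ y, K x y ∂ρ = kernelForm K ρ ρ := by
  have hV : Measurable fun x => ∫⁻ y, K x y ∂ρ := hK.lintegral_prod_right
  set I := kernelForm K ρ ρ with hI
  have hge : ∀ᵐ x ∂ρ, I ≤ ∫⁻ y, K x y ∂ρ := by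
    -- If `A` had positive mass, moving mass towards `ρ` conditioned on `A` would lower the form to
    -- first order.
    set A := {x | ∫⁻ y, K x y ∂ρ < I} with hA
    have hAm : MeasurableSet A := measurableSet_lt hV measurable_const
    have hA0 : ρ A = 0 := by
      by_contra hne
      have : IsProbabilityMeasure (ProbabilityTheory.cond ρ A) :=
        ProbabilityTheory.cond_isProbabilityMeasure hne
      set ν := ProbabilityTheory.cond ρ A with hν
      have hinv : (ρ A)⁻¹ ≠ ⊤ := by simpa using hne
      have hlt : kernelForm K ν ρ < I := by
        have hae : ∀ᵐ x ∂ν, ∫⁻ y, K x y ∂ρ < I :=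
          ProbabilityTheory.ae_cond_mem hAm
        have h1 : kernelForm K ν ρ < ∫⁻ _, I ∂ν := by
          refine lintegral_strict_mono (IsProbabilityMeasure.ne_zero ν) aemeasurable_const ?_ hae
          refine ne_top_of_le_ne_top hfin ?_
          calc ∫⁻ x, ∫⁻ y, K x y ∂ρ ∂ν ≤ ∫⁻ _, I ∂ν :=
                lintegral_mono_ae (hae.mono fun _ h => h.le)
            _ = I := by simp
        simpa using h1
      have hle : ∀ f : X → ENNReal, ∫⁻ x, f x ∂ν ≤ (ρ A)⁻¹ * ∫⁻ x, f x ∂ρ := by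
        intro f
        rw [hν, ProbabilityTheory.cond, lintegral_smul_measure, smul_eq_mul]
        gcongr
        exact Measure.restrict_le_self
      -- The second-order term is finite because `ν ≤ (ρ A)⁻¹ • ρ`.
      have hY : kernelForm K ν ν ≠ ⊤ := by
        rw [kernelForm]
        refine ne_top_of_le_ne_top (ENNReal.mul_ne_top hinv hlt.ne_top) ?_
        rw [kernelForm, ← lintegral_const_mul _ hV]
        exact lintegral_mono fun x => hle _
      refine absurd hlt (not_lt.2 ?_)
      rw [← ENNReal.toReal_le_toReal hfin hlt.ne_top]
      refine le_of_forall_le_quadratic ENNReal.toReal_nonneg ENNReal.toReal_nonneg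
        (ENNReal.toReal_nonneg (a := kernelForm K ν ν)) fun t ht0 ht1 => ?_
      have hs0 : 0 ≤ 1 - t := by linarith
      have hprob : IsProbabilityMeasure
          (ENNReal.ofReal (1 - t) • ρ + ENNReal.ofReal t • ν) := by
        constructor
        simp [← ENNReal.ofReal_add hs0 ht0.le]
      have h := hmin _ hprob
      rw [kernelForm_mix hK hsymm, ← hI] at h
      have hX := hlt.ne_top
      have hfin' : I ≠ ⊤ := hfin
      have h' := ENNReal.toReal_mono (by finiteness) h
      rw [ENNReal.toReal_add (by finiteness) (by finiteness),
        ENNReal.toReal_add (by finiteness) (by finiteness)] at h'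
      simpa [ENNReal.toReal_mul, ENNReal.toReal_ofReal hs0, ENNReal.toReal_ofReal ht0.le] using h'
    filter_upwards [compl_mem_ae_iff.2 hA0] with x hx
    exact not_lt.1 hx
  -- The potential is at least `I` and has mean exactly `I`, so equality holds almost everywhere.
  have := ae_eq_of_ae_le_of_lintegral_le (μ := ρ) (f := fun _ => I) hge (by simpa using hfin)
    hV.aemeasurable (by simp [hI, kernelForm])
  exact this.symm

end kernelForm

/-! ### Concentration and support. -/

/-- If a minimizer has potential at most `C` almost everywhere and the kernel is at least `G > 2 C`
at distances above `L`, then it is concentrated on a set of diameter at most `2 L`. -/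
theorem exists_ae_dist_le {X : Type*} [PseudoMetricSpace X] [MeasurableSpace X]
    [OpensMeasurableSpace X] {K : X → X → ENNReal} {ρ : Measure X}
    [IsProbabilityMeasure ρ] {C G : ENNReal} {L : ℝ} (hG : 2 * C < G)
    (hfar : ∀ x y, L < dist y x → G ≤ K x y) (hV : ∀ᵐ x ∂ρ, ∫⁻ y, K x y ∂ρ ≤ C) :
    ∃ S : Set X, S ∈ ae ρ ∧ ∀ x ∈ S, ∀ y ∈ S, dist x y ≤ 2 * L := by
  refine ⟨{x | ∫⁻ y, K x y ∂ρ ≤ C}, hV, fun x hx x' hx' => ?_⟩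
  have key : ∀ x, ∫⁻ y, K x y ∂ρ ≤ C → ρ (Metric.closedBall x L)ᶜ < 1 / 2 := by
    intro x hx
    have h1 : G * ρ (Metric.closedBall x L)ᶜ ≤ C := by
      refine le_trans ?_ hx
      rw [← setLIntegral_const]
      refine le_trans (setLIntegral_mono' Metric.isClosed_closedBall.measurableSet.compl
        fun y hy => hfar x y ?_) (setLIntegral_le_lintegral _ _)
      simpa using hy
    by_contra! h2
    have h3 : G ≤ 2 * C := by
      calc G = 2 * (G * (1 / 2)) := by
            rw [mul_comm G, ← mul_assoc, one_div, ENNReal.mul_inv_cancel (by simp) (by simp),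
              one_mul]
        _ ≤ 2 * (G * ρ (Metric.closedBall x L)ᶜ) := by gcongr
        _ ≤ 2 * C := by gcongr
    exact absurd hG (not_lt.2 h3)
  -- Disjoint balls would have complements covering the space, each of mass below one half.
  have hne : ((Metric.closedBall x L) ∩ (Metric.closedBall x' L)).Nonempty := by
    by_contra hempty
    rw [Set.not_nonempty_iff_eq_empty] at hempty
    have : (1 : ENNReal) < 1 := by
      calc (1 : ENNReal) = ρ Set.univ := measure_univ.symm
        _ = ρ ((Metric.closedBall x L)ᶜ ∪ (Metric.closedBall x' L)ᶜ) := by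
            rw [← Set.compl_inter, hempty, Set.compl_empty]
        _ ≤ ρ (Metric.closedBall x L)ᶜ + ρ (Metric.closedBall x' L)ᶜ := measure_union_le _ _
        _ < 1 / 2 + 1 / 2 := ENNReal.add_lt_add (key x hx) (key x' hx')
        _ = 1 := ENNReal.add_halves 1
    exact this.false
  obtain ⟨z, hz, hz'⟩ := hne
  linarith [dist_triangle_left x x' z, Metric.mem_closedBall.1 hz, Metric.mem_closedBall.1 hz']

/-- The support of a measure concentrated on a set of finite diameter is bounded and has the same
diameter bound; the barycenter is at most that far from the support. -/
theorem isCompact_support_and_subset_of_ae_dist_le {E : Type*} [NormedAddCommGroup E]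
    [NormedSpace ℝ E] [FiniteDimensional ℝ E] [MeasurableSpace E] [BorelSpace E] {ρ : Measure E}
    [IsProbabilityMeasure ρ] {S : Set E} {D : ℝ} (hS : S ∈ ae ρ)
    (hD : ∀ x ∈ S, ∀ y ∈ S, dist x y ≤ D) :
    IsCompact ρ.support ∧ (∫ x, x ∂ρ = 0 → ρ.support ⊆ Metric.closedBall 0 D) := by
  have : ProperSpace E := FiniteDimensional.proper_real E
  have hsub : ρ.support ⊆ closure S :=
    Measure.support_subset_of_isClosed isClosed_closure (mem_of_superset hS subset_closure)
  have hbdd : Bornology.IsBounded S := Metric.isBounded_iff.2 ⟨D, fun x hx y hy => hD x hx y hy⟩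
  refine ⟨Metric.isCompact_of_isClosed_isBounded Measure.isClosed_support
    (hbdd.closure.subset hsub), fun h0 => hsub.trans ?_⟩
  refine closure_minimal (fun x hx => ?_) Metric.isClosed_closedBall
  obtain ⟨r, hr⟩ := hbdd.exists_norm_le
  have hint : Integrable (fun y : E => y) ρ :=
    Integrable.of_bound aestronglyMeasurable_id r (mem_of_superset hS hr)
  -- As the barycenter is 0, `x` is an average of differences `x - y` of norm at most `D`.
  have h1 : ∫ y, (x - y) ∂ρ = x := by
    rw [integral_sub (integrable_const x) hint, h0]; simp
  have h2 : ‖∫ y, (x - y) ∂ρ‖ ≤ D := by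
    have := norm_integral_le_of_norm_le_const (μ := ρ) (f := fun y => x - y) (C := D)
      (mem_of_superset hS fun y hy => by simpa [dist_eq_norm] using hD x hx y hy)
    simpa using this
  rw [h1] at h2
  simpa using h2

/-! ### One-variable estimates for power terms. -/

section powerTerm

lemma powerTerm_of_pos {c : ℝ} (hc : 0 < c) (t : ℝ) : powerTerm c t = t ^ c / c :=
  if_neg hc.ne'

lemma powerTerm_zero_of_pos {c : ℝ} (hc : 0 < c) : powerTerm c 0 = 0 := by
  rw [powerTerm_of_pos hc, Real.zero_rpow hc.ne', zero_div]

/-- Bernoulli's inequality: `(t ^ c - 1) / c` is increasing in `c > 0`. -/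
lemma powerTerm_sub_inv_mono {c a t : ℝ} (hc : 0 < c) (hca : c ≤ a) (ht : 0 ≤ t) :
    powerTerm c t - 1 / c ≤ powerTerm a t - 1 / a := by
  have ha : 0 < a := hc.trans_le hca
  rw [powerTerm_of_pos hc, powerTerm_of_pos ha]
  have h := one_add_mul_self_le_rpow_one_add (s := t ^ c - 1)
    (by linarith [Real.rpow_nonneg ht c]) ((one_le_div hc).2 hca)
  rw [add_sub_cancel, ← Real.rpow_mul ht, mul_div_cancel₀ _ hc.ne'] at h
  have e : t ^ c / c - 1 / c = (1 + a / c * (t ^ c - 1) - 1) / a := by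
    field_simp; ring
  rw [e, ← sub_div]
  gcongr

lemma powerTerm_zero_left : powerTerm 0 = Real.log := by
  ext t
  simp [powerTerm]

lemma continuousAt_powerTerm (c : ℝ) {t : ℝ} (ht : t ≠ 0) : ContinuousAt (powerTerm c) t := by
  by_cases hc : c = 0
  · subst hc
    simpa [powerTerm_zero_left] using ht
  · have : powerTerm c = fun t => t ^ c / c := by ext; simp [powerTerm, hc]
    rw [this]
    exact (Real.continuousAt_rpow_const _ _ (Or.inl ht)).div_const _

lemma continuous_powerTerm {c : ℝ} (hc : 0 < c) : Continuous (powerTerm c) := by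
  rw [funext (powerTerm_of_pos hc)]
  exact (Real.continuous_rpow_const hc.le).div_const _

lemma tendsto_powerTerm_nhdsGT_zero {c : ℝ} (hc : c ≤ 0) :
    Tendsto (powerTerm c) (𝓝[>] 0) atBot := by
  rcases hc.eq_or_lt with rfl | hc
  · simpa only [powerTerm_zero_left] using Real.tendsto_log_nhdsGT_zero
  · have : powerTerm c = fun t => t ^ c / c := by ext; simp [powerTerm, hc.ne]
    rw [this]
    exact (tendsto_rpow_neg_nhdsGT_zero hc).atTop_div_const_of_neg hc

lemma tendsto_powerTerm_sub_nhdsGT_zero {a b : ℝ} (ha : 0 < a) (hb : b ≤ 0) :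
    Tendsto (fun t => powerTerm a t - powerTerm b t) (𝓝[>] 0) atTop := by
  have h1 : Tendsto (powerTerm a) (𝓝[>] 0) (𝓝 0) := by
    simpa [powerTerm_zero_of_pos ha] using
      ((continuous_powerTerm ha).tendsto 0).mono_left nhdsWithin_le_nhds
  simpa [sub_eq_add_neg, Function.comp_def] using
    h1.add_atTop (tendsto_neg_atBot_atTop.comp (tendsto_powerTerm_nhdsGT_zero hb))

lemma exists_le_powerTerm_sub {a b : ℝ} (ha : 0 < a) (hba : b < a) :
    ∃ m : ℝ, ∀ t : ℝ, 0 ≤ t → m ≤ powerTerm a t - powerTerm b t := by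
  rcases lt_trichotomy b 0 with hb | rfl | hb
  · refine ⟨0, fun t ht => ?_⟩
    rw [powerTerm_of_pos ha, powerTerm, if_neg hb.ne]
    have h1 : 0 ≤ t ^ a / a := by positivity
    have h2 := div_nonpos_of_nonneg_of_nonpos (Real.rpow_nonneg ht b) hb.le
    linarith
  · refine ⟨0, fun t ht => ?_⟩
    rw [powerTerm_of_pos ha, powerTerm, if_pos rfl]
    linarith [Real.log_le_rpow_div ht ha]
  · exact ⟨1 / a - 1 / b, fun t ht => by linarith [powerTerm_sub_inv_mono hb hba.le ht]⟩

lemma tendsto_powerTerm_sub_atTop {a b : ℝ} (ha : 0 < a) (hba : b < a) :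
    Tendsto (fun t => powerTerm a t - powerTerm b t) atTop atTop := by
  -- A positive exponent strictly between `b` and `a` handles all signs of `b`: the difference of
  -- the `c` and `b` terms is bounded below, and that of the `a` and `c` terms tends to infinity.
  set c := (max b 0 + a) / 2 with hc
  have hmax : max b 0 < a := max_lt hba ha
  have hbc : b < c := by linarith [le_max_left b 0]
  have hc0 : 0 < c := by linarith [le_max_right b 0]
  have hca : c < a := by linarith
  obtain ⟨m, hm⟩ := exists_le_powerTerm_sub hc0 hbc
  have h1 : Tendsto (fun t : ℝ => t ^ c * (t ^ (a - c) / a - 1 / c)) atTop atTop :=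
    (tendsto_rpow_atTop hc0).atTop_mul_atTop₀ (tendsto_atTop_add_const_right _ _
      ((tendsto_rpow_atTop (sub_pos.2 hca)).atTop_div_const ha))
  refine tendsto_atTop_mono' _ ?_ (tendsto_atTop_add_const_right _ m h1)
  filter_upwards [eventually_gt_atTop 0] with t ht
  have h2 : t ^ c * (t ^ (a - c) / a - 1 / c) = powerTerm a t - powerTerm c t := by
    rw [powerTerm_of_pos ha, powerTerm_of_pos hc0, mul_sub, ← mul_div_assoc, ← Real.rpow_add ht]
    congr 2 <;> ring_nf
  linarith [hm t ht.le]

/-- In polar coordinates the radial density is `t ^ (dim - 1 + c) / c`, whose exponent exceeds `-1`;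
for `c = 0` the logarithm is integrable. -/
lemma integrableOn_powerTerm_norm {E : Type*} [NormedAddCommGroup E] [NormedSpace ℝ E]
    [Nontrivial E] [FiniteDimensional ℝ E] [MeasurableSpace E] [BorelSpace E] (μ : Measure E)
    [μ.IsAddHaarMeasure] {c : ℝ} (hc : -(Module.finrank ℝ E : ℝ) < c) (r : ℝ) :
    IntegrableOn (fun x : E => powerTerm c ‖x‖) (Metric.ball 0 r) μ := by
  rw [integrableOn_fun_norm_addHaar μ (f := powerTerm c)]
  rcases le_or_gt r 0 with hr | hr
  · simp [Set.Ioo_eq_empty (not_lt.2 hr)]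
  have hpos : 1 ≤ Module.finrank ℝ E := Module.finrank_pos
  rw [← integrableOn_Ioc_iff_integrableOn_Ioo, ← intervalIntegrable_iff_integrableOn_Ioc_of_le hr.le]
  by_cases hc0 : c = 0
  · subst hc0
    simp only [powerTerm, if_true, smul_eq_mul]
    exact intervalIntegral.intervalIntegrable_log'.continuousOn_mul (by fun_prop)
  · have h1 : -1 < ((Module.finrank ℝ E - 1 : ℕ) : ℝ) + c := by
      rw [Nat.cast_sub hpos, Nat.cast_one]; linarith
    refine ((intervalIntegral.intervalIntegrable_rpow' h1 (a := 0) (b := r)).div_const c).congr ?_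
    intro t ht
    rw [Set.uIoc_of_le hr.le] at ht
    simp only [powerTerm, if_neg hc0, smul_eq_mul]
    rw [Real.rpow_add ht.1, Real.rpow_natCast, mul_div_assoc]

end powerTerm

/-! ### From the extended-real energy to a nonnegative kernel. -/

section energy

variable {d : ℕ} {W : EuclideanSpace ℝ (Fin d) → EReal}

/-- The nonnegative kernel `W (x - y) + M` of a potential `W ≥ -M`. -/
noncomputable def shiftedKernel (W : EuclideanSpace ℝ (Fin d) → EReal) (M : ℝ)
    (x y : EuclideanSpace ℝ (Fin d)) : ENNReal :=
  (W (x - y) + (M : EReal)).toENNReal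

lemma measurable_shiftedKernel (hW : Measurable W) (M : ℝ) :
    Measurable (Function.uncurry (shiftedKernel W M)) := by
  unfold shiftedKernel
  refine Measurable.ereal_toENNReal ?_
  exact (hW.comp (measurable_fst.sub measurable_snd)).add measurable_const

/-- This is `w + M = w⁺ - w⁻ + M` rearranged without subtraction, so that it can be integrated in
`ENNReal` and survives `w = ⊤`. -/
lemma EReal.toENNReal_add_add_toENNReal_neg {w : EReal} {M : ℝ} (hM : 0 ≤ M)
    (hw : ((-M : ℝ) : EReal) ≤ w) :
    (w + (M : EReal)).toENNReal + (-w).toENNReal = w.toENNReal + ENNReal.ofReal M := by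
  induction w with
  | bot => simp at hw
  | top => simp
  | coe r =>
    have hr : -M ≤ r := by exact_mod_cast hw
    rw [← EReal.coe_add, ← EReal.coe_neg]
    simp only [EReal.real_coe_toENNReal]
    rcases le_total 0 r with h | h
    · rw [ENNReal.ofReal_of_nonpos (neg_nonpos.2 h), add_zero, ENNReal.ofReal_add h hM]
    · rw [ENNReal.ofReal_of_nonpos h, zero_add, ← ENNReal.ofReal_add (by linarith) (by linarith)]
      congr 1; ring

lemma kernelForm_add_lintegral_neg (hW : Measurable W) {M : ℝ} (hM : 0 ≤ M)
    (hlow : ∀ x, ((-M : ℝ) : EReal) ≤ W x) (ρ : Measure (EuclideanSpace ℝ (Fin d)))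
    [IsProbabilityMeasure ρ] :
    kernelForm (shiftedKernel W M) ρ ρ + ∫⁻ x, ∫⁻ y, (-W (x - y)).toENNReal ∂ρ ∂ρ =
      (∫⁻ x, ∫⁻ y, (W (x - y)).toENNReal ∂ρ ∂ρ) + ENNReal.ofReal M := by
  have hK := measurable_shiftedKernel hW M
  have hKx : ∀ x, Measurable (shiftedKernel W M x) := fun x => hK.of_uncurry_left
  have hP : Measurable (Function.uncurry fun x y => (W (x - y)).toENNReal) :=
    (hW.comp (measurable_fst.sub measurable_snd)).ereal_toENNReal
  have hPx : ∀ x, Measurable fun y => (W (x - y)).toENNReal := fun x => hP.of_uncurry_left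
  unfold kernelForm
  rw [← lintegral_add_left hK.lintegral_prod_right]
  have h1 : ∀ x, ∫⁻ y, shiftedKernel W M x y ∂ρ + ∫⁻ y, (-W (x - y)).toENNReal ∂ρ =
      ∫⁻ y, (W (x - y)).toENNReal ∂ρ + ENNReal.ofReal M := by
    intro x
    rw [← lintegral_add_left (hKx x)]
    simp only [shiftedKernel, EReal.toENNReal_add_add_toENNReal_neg hM (hlow _)]
    rw [lintegral_add_left (hPx x)]
    simp
  simp_rw [h1]
  rw [lintegral_add_left hP.lintegral_prod_right]
  simp

lemma lintegral_neg_le {M : ℝ}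
    (hlow : ∀ x, ((-M : ℝ) : EReal) ≤ W x) (ρ : Measure (EuclideanSpace ℝ (Fin d)))
    [IsProbabilityMeasure ρ] :
    ∫⁻ x, ∫⁻ y, (-W (x - y)).toENNReal ∂ρ ∂ρ ≤ ENNReal.ofReal M := by
  have h : ∀ z, (-W z).toENNReal ≤ ENNReal.ofReal M := fun z => by
    rw [← EReal.real_coe_toENNReal]
    refine EReal.toENNReal_le_toENNReal (EReal.neg_le.1 ?_)
    simpa using hlow z
  calc ∫⁻ x, ∫⁻ y, (-W (x - y)).toENNReal ∂ρ ∂ρ ≤ ∫⁻ _, ∫⁻ _, ENNReal.ofReal M ∂ρ ∂ρ :=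
        lintegral_mono fun x => lintegral_mono fun y => h _
    _ = ENNReal.ofReal M := by simp

lemma half_mul_coe_sub_coe {p n : ENNReal} (hp : p ≠ ⊤) (hn : n ≠ ⊤) :
    ((1 / 2 : ℝ) : EReal) * ((p : EReal) - (n : EReal)) =
      ((1 / 2 * (p.toReal - n.toReal) : ℝ) : EReal) := by
  rw [← EReal.coe_ennreal_toReal hp, ← EReal.coe_ennreal_toReal hn, ← EReal.coe_sub,
    ← EReal.coe_mul]

lemma half_mul_top : ((1 / 2 : ℝ) : EReal) * ⊤ = ⊤ :=
  EReal.coe_mul_top_of_pos (by norm_num)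

lemma half_mul_top_sub_coe {n : ENNReal} (hn : n ≠ ⊤) :
    ((1 / 2 : ℝ) : EReal) * (((⊤ : ENNReal) : EReal) - (n : EReal)) = ⊤ := by
  rw [← EReal.coe_ennreal_toReal hn, EReal.coe_ennreal_top, EReal.top_sub_coe, half_mul_top]

/-- For finite values the form is twice the energy plus `M`. If the form of `ρ'` is finite, so are
both energies, and hence the form of `ρ`. -/
lemma kernelForm_le_of_interactionEnergy_le (hW : Measurable W) {M : ℝ} (hM : 0 ≤ M)
    (hlow : ∀ x, ((-M : ℝ) : EReal) ≤ W x)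
    {ρ ρ' : ProbabilityMeasure (EuclideanSpace ℝ (Fin d))}
    (h : interactionEnergy W ρ ≤ interactionEnergy W ρ') :
    kernelForm (shiftedKernel W M) ρ ρ ≤ kernelForm (shiftedKernel W M) ρ' ρ' := by
  have e := kernelForm_add_lintegral_neg hW hM hlow (ρ : Measure (EuclideanSpace ℝ (Fin d)))
  have e' := kernelForm_add_lintegral_neg hW hM hlow (ρ' : Measure (EuclideanSpace ℝ (Fin d)))
  have hN := ne_top_of_le_ne_top ENNReal.ofReal_ne_top
    (lintegral_neg_le hlow (ρ : Measure (EuclideanSpace ℝ (Fin d))))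
  have hN' := ne_top_of_le_ne_top ENNReal.ofReal_ne_top
    (lintegral_neg_le hlow (ρ' : Measure (EuclideanSpace ℝ (Fin d))))
  unfold interactionEnergy at h
  generalize kernelForm (shiftedKernel W M) (ρ : Measure (EuclideanSpace ℝ (Fin d))) ρ = J at *
  generalize kernelForm (shiftedKernel W M) (ρ' : Measure (EuclideanSpace ℝ (Fin d))) ρ' = J' at *
  generalize (∫⁻ x, ∫⁻ y, (-W (x - y)).toENNReal ∂(ρ : Measure (EuclideanSpace ℝ (Fin d)))
    ∂(ρ : Measure (EuclideanSpace ℝ (Fin d)))) = N at *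
  generalize (∫⁻ x, ∫⁻ y, (-W (x - y)).toENNReal ∂(ρ' : Measure (EuclideanSpace ℝ (Fin d)))
    ∂(ρ' : Measure (EuclideanSpace ℝ (Fin d)))) = N' at *
  generalize (∫⁻ x, ∫⁻ y, (W (x - y)).toENNReal ∂(ρ : Measure (EuclideanSpace ℝ (Fin d)))
    ∂(ρ : Measure (EuclideanSpace ℝ (Fin d)))) = P at *
  generalize (∫⁻ x, ∫⁻ y, (W (x - y)).toENNReal ∂(ρ' : Measure (EuclideanSpace ℝ (Fin d)))
    ∂(ρ' : Measure (EuclideanSpace ℝ (Fin d)))) = P' at *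
  by_cases hJ' : J' = ⊤
  · simp [hJ']
  have hP' : P' ≠ ⊤ := by
    intro hP'
    rw [hP', top_add] at e'
    exact ENNReal.add_ne_top.2 ⟨hJ', hN'⟩ e'
  have hP : P ≠ ⊤ := by
    rintro rfl
    rw [half_mul_top_sub_coe hN, half_mul_coe_sub_coe hP' hN', top_le_iff] at h
    exact EReal.coe_ne_top _ h
  have hJ : J ≠ ⊤ := by
    rintro rfl
    rw [top_add] at e
    exact ENNReal.add_ne_top.2 ⟨hP, ENNReal.ofReal_ne_top⟩ e.symm
  rw [half_mul_coe_sub_coe hP hN, half_mul_coe_sub_coe hP' hN', EReal.coe_le_coe_iff] at h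
  rw [← ENNReal.toReal_le_toReal hJ hJ']
  have e1 := congrArg ENNReal.toReal e
  have e2 := congrArg ENNReal.toReal e'
  rw [ENNReal.toReal_add hJ hN, ENNReal.toReal_add hP ENNReal.ofReal_ne_top] at e1
  rw [ENNReal.toReal_add hJ' hN', ENNReal.toReal_add hP' ENNReal.ofReal_ne_top] at e2
  linarith

lemma interactionEnergy_lt_top_of_kernelForm_ne_top (hW : Measurable W) {M : ℝ} (hM : 0 ≤ M)
    (hlow : ∀ x, ((-M : ℝ) : EReal) ≤ W x)
    {ρ : ProbabilityMeasure (EuclideanSpace ℝ (Fin d))}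
    (h : kernelForm (shiftedKernel W M) ρ ρ ≠ ⊤) : interactionEnergy W ρ < ⊤ := by
  have e := kernelForm_add_lintegral_neg hW hM hlow (ρ : Measure (EuclideanSpace ℝ (Fin d)))
  have hN := ne_top_of_le_ne_top ENNReal.ofReal_ne_top
    (lintegral_neg_le hlow (ρ : Measure (EuclideanSpace ℝ (Fin d))))
  have hP : (∫⁻ x, ∫⁻ y, (W (x - y)).toENNReal ∂(ρ : Measure (EuclideanSpace ℝ (Fin d)))
      ∂(ρ : Measure (EuclideanSpace ℝ (Fin d)))) ≠ ⊤ := by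
    intro hP
    rw [hP, top_add] at e
    exact ENNReal.add_ne_top.2 ⟨h, hN⟩ e
  rw [interactionEnergy, half_mul_coe_sub_coe hP hN]
  exact EReal.coe_lt_top _

/-- A potential with values at least `h` at distances above `L`, one test measure with small
energy: every minimizer is concentrated on a set of diameter at most `2 L`. -/
theorem IsEnergyMinimizer.exists_ae_dist_le (hW : Measurable W) (heven : ∀ x, W (-x) = W x)
    {M : ℝ} (hM : 0 ≤ M) (hlow : ∀ x, ((-M : ℝ) : EReal) ≤ W x)
    {ρ₀ ρ : ProbabilityMeasure (EuclideanSpace ℝ (Fin d))} {C : ENNReal} (hC : C ≠ ⊤)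
    (h₀ : kernelForm (shiftedKernel W M) ρ₀ ρ₀ ≤ C) (hρ : IsEnergyMinimizer W ρ)
    {G : ENNReal} {L : ℝ} (hG : 2 * C < G) (hfar : ∀ z, L < ‖z‖ → G ≤ (W z + (M : EReal)).toENNReal) :
    ∃ S : Set (EuclideanSpace ℝ (Fin d)), S ∈ ae (ρ : Measure (EuclideanSpace ℝ (Fin d))) ∧
      ∀ x ∈ S, ∀ y ∈ S, dist x y ≤ 2 * L := by
  have hle := (kernelForm_le_of_interactionEnergy_le hW hM hlow (hρ ρ₀)).trans h₀
  have hEL := ae_lintegral_eq_of_forall_kernelForm_le (measurable_shiftedKernel hW M)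
    (fun x y => by rw [shiftedKernel, shiftedKernel, ← neg_sub, heven])
    (ρ : Measure (EuclideanSpace ℝ (Fin d))) (ne_top_of_le_ne_top hC hle)
    (fun σ hσ => kernelForm_le_of_interactionEnergy_le hW hM hlow (hρ ⟨σ, hσ⟩))
  refine _root_.exists_ae_dist_le (K := shiftedKernel W M) hG (fun x y hxy => hfar _ ?_)
    (hEL.mono fun x hx => hx.le.trans hle)
  rwa [← dist_eq_norm, dist_comm]

end energy

/-! ### Power-law potentials, with bounds uniform in `a ≥ a₀`. -/

section powerLaw

variable {d : ℕ} {a b : ℝ}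

lemma powerLawPotential_of_ne (a b : ℝ) {x : EuclideanSpace ℝ (Fin d)} (hx : x ≠ 0) :
    powerLawPotential d a b x = ((powerTerm a ‖x‖ - powerTerm b ‖x‖ : ℝ) : EReal) := by
  simp [powerLawPotential, hx]

lemma coe_le_powerLawPotential (a b : ℝ) (x : EuclideanSpace ℝ (Fin d)) :
    ((powerTerm a ‖x‖ - powerTerm b ‖x‖ : ℝ) : EReal) ≤ powerLawPotential d a b x := by
  unfold powerLawPotential
  split_ifs
  · exact le_top
  · exact le_rfl

lemma powerLawPotential_neg (a b : ℝ) (x : EuclideanSpace ℝ (Fin d)) :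
    powerLawPotential d a b (-x) = powerLawPotential d a b x := by
  simp [powerLawPotential]

lemma continuousAt_powerLawPotential (a b : ℝ) {x : EuclideanSpace ℝ (Fin d)} (hx : x ≠ 0) :
    ContinuousAt (powerLawPotential d a b) x := by
  have h : ContinuousAt (fun x : EuclideanSpace ℝ (Fin d) =>
      ((powerTerm a ‖x‖ - powerTerm b ‖x‖ : ℝ) : EReal)) x := by
    have hn : ‖x‖ ≠ 0 := norm_ne_zero_iff.2 hx
    refine continuous_coe_real_ereal.continuousAt.comp (f := fun x : EuclideanSpace ℝ (Fin d) =>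
      powerTerm a ‖x‖ - powerTerm b ‖x‖) ?_
    exact ((continuousAt_powerTerm a hn).comp continuous_norm.continuousAt).sub
      ((continuousAt_powerTerm b hn).comp continuous_norm.continuousAt)
  refine h.congr ?_
  filter_upwards [isOpen_ne.mem_nhds hx] with y hy
  exact (powerLawPotential_of_ne a b hy).symm

lemma lowerSemicontinuous_powerLawPotential (ha : 0 < a) (b : ℝ) :
    LowerSemicontinuous (powerLawPotential d a b) := by
  intro x
  by_cases hx : x = 0
  swap
  · exact (continuousAt_powerLawPotential a b hx).lowerSemicontinuousAt
  subst hx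
  rcases le_or_gt b 0 with hb | hb
  · intro y hy
    -- The value at the origin is `⊤`, so the point itself is treated apart from its punctured
    -- neighbourhoods, where the real formula blows up.
    rw [← nhdsNE_sup_pure]
    refine Filter.eventually_sup.2 ⟨?_, by simpa using hy⟩
    have hlim := EReal.tendsto_coe_nhds_top_iff.2 ((tendsto_powerTerm_sub_nhdsGT_zero ha hb).comp
      (tendsto_norm_nhdsNE_zero (E := EuclideanSpace ℝ (Fin d))))
    have hyt : y < ⊤ := hy.trans_le le_top
    filter_upwards [hlim.eventually (lt_mem_nhds hyt)] with z hz
    exact lt_of_lt_of_le hz (coe_le_powerLawPotential a b z)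
  · have : powerLawPotential d a b = fun x =>
        ((powerTerm a ‖x‖ - powerTerm b ‖x‖ : ℝ) : EReal) := by
      ext x; simp [powerLawPotential, not_le.2 hb]
    rw [this]
    refine ContinuousAt.lowerSemicontinuousAt (Continuous.continuousAt ?_)
    exact continuous_coe_real_ereal.comp (((continuous_powerTerm ha).comp continuous_norm).sub
      ((continuous_powerTerm hb).comp continuous_norm))

lemma tendsto_powerLawPotential_cocompact (ha : 0 < a) (hba : b < a) :
    Tendsto (powerLawPotential d a b) (cocompact (EuclideanSpace ℝ (Fin d))) (𝓝 ⊤) := by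
  have hlim := EReal.tendsto_coe_nhds_top_iff.2 ((tendsto_powerTerm_sub_atTop ha hba).comp
    (tendsto_norm_cocompact_atTop (E := EuclideanSpace ℝ (Fin d))))
  exact tendsto_nhds_top_mono hlim (Eventually.of_forall (coe_le_powerLawPotential a b))

lemma exists_forall_ge_le_powerLawPotential {a₀ : ℝ} (ha₀ : 0 < a₀) (hb : b < a₀) :
    ∃ M : ℝ, 0 ≤ M ∧ ∀ a, a₀ ≤ a → ∀ x : EuclideanSpace ℝ (Fin d),
      ((-M : ℝ) : EReal) ≤ powerLawPotential d a b x := by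
  obtain ⟨m, hm⟩ := exists_le_powerTerm_sub ha₀ hb
  refine ⟨max 0 (1 / a₀ - m), le_max_left _ _, fun a ha x => ?_⟩
  refine le_trans (EReal.coe_le_coe_iff.2 ?_) (coe_le_powerLawPotential a b x)
  have h1 : 0 < 1 / a := one_div_pos.2 (ha₀.trans_le ha)
  linarith [hm ‖x‖ (norm_nonneg x), powerTerm_sub_inv_mono ha₀ ha (norm_nonneg x),
    le_max_right 0 (1 / a₀ - m)]

lemma lintegral_abs_powerLawPotential_lt_top (hd : 1 ≤ d) (ha : 0 < a) (hb : -(d : ℝ) < b)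
    {s : Set (EuclideanSpace ℝ (Fin d))} (hs : Bornology.IsBounded s) :
    ∫⁻ x in s, (powerLawPotential d a b x).abs < ⊤ := by
  have : Nonempty (Fin d) := ⟨⟨0, hd⟩⟩
  obtain ⟨r, hr⟩ := hs.subset_ball 0
  have hint : IntegrableOn (fun x : EuclideanSpace ℝ (Fin d) =>
      powerTerm a ‖x‖ - powerTerm b ‖x‖) (Metric.ball 0 r) := by
    refine (integrableOn_powerTerm_norm volume ?_ r).sub (integrableOn_powerTerm_norm volume ?_ r)
    · rw [finrank_euclideanSpace_fin]
      exact lt_of_le_of_lt (neg_nonpos.2 (Nat.cast_nonneg d)) ha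
    · rwa [finrank_euclideanSpace_fin]
  refine lt_of_le_of_lt ?_ (hint.mono_set hr).2
  refine lintegral_mono_ae (ae_restrict_of_ae ?_)
  have h0 : ∀ᵐ x : EuclideanSpace ℝ (Fin d), x ≠ 0 := by
    simp [ae_iff]
  filter_upwards [h0] with x hx
  rw [powerLawPotential_of_ne a b hx, EReal.abs_def, ← Real.norm_eq_abs, ofReal_norm]

lemma basicAssumption_powerLawPotential (hd : 1 ≤ d) (ha : 0 < a) (hb : -(d : ℝ) < b)
    (hba : b < a) : BasicAssumption (powerLawPotential d a b) where
  locallyIntegrable _ hK := lintegral_abs_powerLawPotential_lt_top hd ha hb hK.isBounded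
  boundedBelow := by
    obtain ⟨M, -, hM⟩ := exists_forall_ge_le_powerLawPotential (d := d) ha hba
    exact ⟨-M, hM a le_rfl⟩
  lowerSemicontinuous := lowerSemicontinuous_powerLawPotential ha b
  even := powerLawPotential_neg a b

/-- The uniform measure on a ball of radius `1 / 2` has energy bounded uniformly in `a ≥ a₀`. -/
lemma exists_forall_ge_kernelForm_powerLawPotential_le (hd : 1 ≤ d) {a₀ : ℝ} (ha₀ : 0 < a₀)
    (hb : -(d : ℝ) < b) (M : ℝ) :
    ∃ (ρ₀ : ProbabilityMeasure (EuclideanSpace ℝ (Fin d))) (C : ENNReal), C ≠ ⊤ ∧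
      ∀ a, a₀ ≤ a → kernelForm (shiftedKernel (powerLawPotential d a b) M) ρ₀ ρ₀ ≤ C := by
  have : Nonempty (Fin d) := ⟨⟨0, hd⟩⟩
  set B : Set (EuclideanSpace ℝ (Fin d)) := Metric.ball 0 (1 / 2) with hB
  have hB0 : volume B ≠ 0 := (Metric.measure_ball_pos _ _ (by norm_num)).ne'
  have hprob : IsProbabilityMeasure (ProbabilityTheory.cond volume B) :=
    ProbabilityTheory.cond_isProbabilityMeasure_of_finite hB0 measure_ball_lt_top.ne
  -- Differences of points of `B` have norm below 1, where `k` dominates the shifted potential off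
  -- the origin for every `a ≥ a₀`.
  set k : EuclideanSpace ℝ (Fin d) → ENNReal := (Metric.ball 0 1).indicator fun z =>
    ENNReal.ofReal (1 / a₀ - powerTerm b ‖z‖ + M) with hk
  have hkfin : ∫⁻ z, k z ≠ ⊤ := by
    rw [hk, lintegral_indicator Metric.isOpen_ball.measurableSet]
    have hint : IntegrableOn (fun z : EuclideanSpace ℝ (Fin d) =>
        1 / a₀ - powerTerm b ‖z‖ + M) (Metric.ball 0 1) := by
      have hc : ∀ c : ℝ, IntegrableOn (fun _ : EuclideanSpace ℝ (Fin d) => c)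
        (Metric.ball 0 1) := fun c => integrableOn_const measure_ball_lt_top.ne
      refine ((hc _).sub (integrableOn_powerTerm_norm volume ?_ 1)).add (hc _)
      rwa [finrank_euclideanSpace_fin]
    exact hint.lintegral_lt_top.ne
  refine ⟨⟨ProbabilityTheory.cond volume B, hprob⟩, (volume B)⁻¹ * ∫⁻ z, k z,
    ENNReal.mul_ne_top (ENNReal.inv_ne_top.2 hB0) hkfin, fun a ha => ?_⟩
  have ha0 : 0 < a := ha₀.trans_le ha
  have hinner : ∀ x ∈ B, ∫⁻ y, shiftedKernel (powerLawPotential d a b) M x y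
      ∂(ProbabilityTheory.cond volume B) ≤ (volume B)⁻¹ * ∫⁻ z, k z := by
    intro x hx
    rw [ProbabilityTheory.cond, lintegral_smul_measure, smul_eq_mul]
    refine mul_le_mul' le_rfl ?_
    -- Substituting `x - y` over the whole space makes the bound independent of `x`.
    rw [← lintegral_sub_left_eq_self k x]
    refine le_trans ?_ (setLIntegral_le_lintegral B _)
    refine lintegral_mono_ae ?_
    have h0 : ∀ᵐ y : EuclideanSpace ℝ (Fin d), y ≠ x := by simp [ae_iff]
    filter_upwards [ae_restrict_of_ae h0,
      ae_restrict_mem Metric.isOpen_ball.measurableSet] with y hyx hy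
    have hz : x - y ≠ 0 := sub_ne_zero.2 hyx.symm
    have hz1 : ‖x - y‖ < 1 := by
      rw [hB, mem_ball_zero_iff] at hx
      rw [mem_ball_zero_iff] at hy
      linarith [norm_sub_le x y]
    rw [hk, Set.indicator_of_mem (mem_ball_zero_iff.2 hz1), shiftedKernel,
      powerLawPotential_of_ne a b hz, ← EReal.coe_add, EReal.real_coe_toENNReal]
    refine ENNReal.ofReal_le_ofReal ?_
    have h1 : powerTerm a ‖x - y‖ ≤ 1 / a₀ := by
      rw [powerTerm_of_pos ha0]
      exact div_le_div₀ zero_le_one (Real.rpow_le_one (norm_nonneg _) hz1.le ha0.le) ha₀ ha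
    linarith
  calc kernelForm (shiftedKernel (powerLawPotential d a b) M)
        (ProbabilityTheory.cond volume B) (ProbabilityTheory.cond volume B)
      ≤ ∫⁻ _, ((volume B)⁻¹ * ∫⁻ z, k z) ∂(ProbabilityTheory.cond volume B) := by
        refine lintegral_mono_ae ?_
        filter_upwards [ProbabilityTheory.ae_cond_mem (μ := (volume :
          Measure (EuclideanSpace ℝ (Fin d)))) (s := B) Metric.isOpen_ball.measurableSet] with x hx
        exact hinner x hx
    _ = (volume B)⁻¹ * ∫⁻ z, k z := by rw [lintegral_const, measure_univ, mul_one]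

lemma exists_forall_ge_le_powerLawPotential_of_lt_norm {a₀ : ℝ} (ha₀ : 0 < a₀) (hb : b < a₀)
    (g : ℝ) : ∃ L : ℝ, 0 < L ∧ ∀ a, a₀ ≤ a → ∀ x : EuclideanSpace ℝ (Fin d), L < ‖x‖ →
      (g : EReal) ≤ powerLawPotential d a b x := by
  obtain ⟨L, hL⟩ := eventually_atTop.1
    ((tendsto_powerTerm_sub_atTop ha₀ hb).eventually_ge_atTop (g + 1 / a₀))
  refine ⟨max L 1, by positivity, fun a ha x hx => ?_⟩
  refine le_trans (EReal.coe_le_coe_iff.2 ?_) (coe_le_powerLawPotential a b x)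
  have h1 : 0 < 1 / a := one_div_pos.2 (ha₀.trans_le ha)
  linarith [hL ‖x‖ ((le_max_left L 1).trans hx.le),
    powerTerm_sub_inv_mono ha₀ ha (norm_nonneg x)]

end powerLaw

/-! ### The main theorem. -/

theorem theorem2p3 (d : ℕ) (hd : 1 ≤ d) (b a₀ : ℝ) (hb : -(d : ℝ) < b) (ha₀ : max b 0 < a₀) :
    ∃ R : ℝ, ∀ a : ℝ, a₀ ≤ a → IsUpperBoundOfMinimizerSize (powerLawPotential d a b) R := by
  have hba₀ : b < a₀ := (le_max_left b 0).trans_lt ha₀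
  have h0a₀ : 0 < a₀ := (le_max_right b 0).trans_lt ha₀
  obtain ⟨M, hM, hlow⟩ := exists_forall_ge_le_powerLawPotential (d := d) h0a₀ hba₀
  obtain ⟨ρ₀, C, hC, hρ₀⟩ := exists_forall_ge_kernelForm_powerLawPotential_le hd h0a₀ hb M
  -- After adding `M`, the far level is `2C + 1`, strictly above `2C`.
  obtain ⟨L, hL, hfar⟩ := exists_forall_ge_le_powerLawPotential_of_lt_norm (d := d) h0a₀ hba₀
    (2 * C.toReal + 1 - M)
  refine ⟨2 * L, fun a ha => ?_⟩
  have h0a : 0 < a := h0a₀.trans_le ha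
  have hba : b < a := hba₀.trans_le ha
  have hmeas : Measurable (powerLawPotential d a b) :=
    (lowerSemicontinuous_powerLawPotential h0a b).measurable
  have hG : 2 * C < ENNReal.ofReal (2 * C.toReal + 1) := by
    rw [ENNReal.lt_ofReal_iff_toReal_lt (by finiteness), ENNReal.toReal_mul]
    simp
  have hfar' : ∀ z, L < ‖z‖ → ENNReal.ofReal (2 * C.toReal + 1) ≤
      (powerLawPotential d a b z + (M : EReal)).toENNReal := by
    intro z hz
    rw [← EReal.real_coe_toENNReal]
    refine EReal.toENNReal_le_toENNReal ?_
    have h := add_le_add_left (hfar a ha z hz) (M : EReal)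
    rwa [← EReal.coe_add, sub_add_cancel] at h
  have hconc : ∀ ρ, IsEnergyMinimizer (powerLawPotential d a b) ρ → _ := fun ρ hρ =>
    IsEnergyMinimizer.exists_ae_dist_le hmeas (powerLawPotential_neg a b) hM (hlow a ha) hC
      (hρ₀ a ha) hρ hG hfar'
  refine ⟨⟨basicAssumption_powerLawPotential hd h0a hb hba, ⊤, top_ne_bot,
    tendsto_powerLawPotential_cocompact h0a hba, ρ₀, ?_⟩, by positivity, fun ρ hρ => ?_,
    fun ρ hρ => ?_⟩
  -- Since the limit at infinity is `⊤`, any measure of finite energy will do.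
  · rw [half_mul_top]
    exact interactionEnergy_lt_top_of_kernelForm_ne_top hmeas hM (hlow a ha)
      (ne_top_of_le_ne_top hC (hρ₀ a ha))
  · obtain ⟨S, hS, hD⟩ := hconc ρ hρ
    exact (isCompact_support_and_subset_of_ae_dist_le hS hD).1
  · obtain ⟨S, hS, hD⟩ := hconc ρ hρ
    exact (isCompact_support_and_subset_of_ae_dist_le hS hD).2
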